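/- All manifolds are smooth real Banach manifolds without boundary. Let $(M,\omega)$ be a pre-symplectic manifold: $\omega$ is a smooth closed $2$-form on $M$ whose kernels $K_m=\ker\omega_m\subseteq T_mM$ form a smooth vector subbundle $K\subseteq TM$ with typical fibre $F$. Let $\tau:K^*\to M$ be the dual bundle of $K$, and let $P:TM\to K$ be a connection, i.e. a smooth bundle map with $P|_K=\mathrm{id}_K$; vector fields $X$ with $P(X)=0$ are called horizontal, and every vector field splits as $X=X_V+X_H$ with $X_V=P(X)$, $X_H=X-P(X)$. Define a $1$-form on $K^*$ by $\vartheta^P_\mu(\xi)=\mu\big(P(T\tau\,\xi)\big)$, and let $\tilde M\subseteq K^*$ be an open neighbourhood of the zero section on which $$\tilde\omega=\tau^*\omega+d\vartheta^P$$ is (weakly) nondegenerate; $(\tilde M,\tilde\omega)$ is the symplectic thickening of $(M,\omega)$. Assume that $P$ is flat: the Lie bracket of any two (locally defined) horizontal vector fields is horizontal. Call a smooth local frame of $K$ (a smooth family of isomorphisms $e_m:F\to K_m$, $m\in O$, with $O\subseteq M$ open) adapted to $P$ if $P([X,e v])=0$ for every $v\in F$ and every local horizontal vector field $X$ on an open subset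 of $O$; its linear fibre coordinates are the functions $\mu\mapsto\mu_v:=\mu(e_{\tau(\mu)}v)$, $v\in F$, on $\tau^{-1}(O)$. Let $\Gamma$ be a smooth vector field on $M$ with $i_\Gamma\omega=dH$ for some $H\in C^\infty(M)$. Let $\tilde\Gamma=\tilde\Gamma_V+\tilde\Gamma_H$, where $\tilde\Gamma_V,\tilde\Gamma_H$ are smooth vector fields on $\tilde M$ such that - $T\tau(\tilde\Gamma_V)=\Gamma_V$ and $\mathcal L_{\tilde\Gamma_V}\vartheta^P=0$; - $T\tau(\tilde\Gamma_H)=\Gamma_H$, and around every point of $\tilde M$ the fibre coordinates of some adapted local frame are held constant by $\tilde\Gamma_H$: $d\mu_v(\tilde\Gamma_H)=0$ for all $v\in F$. Then $\mathcal L_{\tilde\Gamma}\tilde\omega=0$ on $\tilde M$. -/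

import Mathlib

open Set Bundle
open scoped Manifold ContDiff Topology

noncomputable section

/-! ### Differential forms on (Banach) manifolds without boundary -/

section Forms

variable {E : Type*} [NormedAddCommGroup E] [NormedSpace ℝ E]
  {H : Type*} [TopologicalSpace H] (I : ModelWithCorners ℝ E H)
  {M : Type*} [TopologicalSpace M] [ChartedSpace H M]

variable (M) in
/-- A (not necessarily smooth) differential `k`-form on `M`. -/
abbrev DForm (k : ℕ) : Type _ := ∀ p : M, TangentSpace I p [⋀^Fin k]→L[ℝ] ℝ

variable {I}

/-- The local representative of the form `η` in the preferred chart `φ` at `p`: the pull-back of `η`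
under `φ⁻¹`, a form on the model space (meaningful on the target of `φ`). -/
def DForm.chartRep {k : ℕ} (η : DForm I M k) (p : M) (x : E) : E [⋀^Fin k]→L[ℝ] ℝ :=
  (η ((extChartAt I p).symm x)).compContinuousLinearMap
    ((mfderiv 𝓘(ℝ, E) I (extChartAt I p).symm x) ∘L
      (NormedSpace.fromTangentSpace (𝕜 := ℝ) x).symm.toContinuousLinearMap)

/-- Smoothness of a form: all local representatives are smooth. -/
def DForm.IsSmooth {k : ℕ} (η : DForm I M k) : Prop :=
  ∀ p : M, ContDiffOn ℝ ∞ (η.chartRep p) (extChartAt I p).target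

/-- The exterior derivative, computed at `p` in the preferred chart at `p`
(for manifolds without boundary). -/
def DForm.d {k : ℕ} (η : DForm I M k) : DForm I M (k + 1) := fun p =>
  (extDeriv (η.chartRep p) (extChartAt I p p)).compContinuousLinearMap
    ((NormedSpace.fromTangentSpace (𝕜 := ℝ) (extChartAt I p p)).toContinuousLinearMap ∘L
      (mfderiv I 𝓘(ℝ, E) (extChartAt I p) p))

/-- The contraction `i_Z η` of a form with a vector field. -/
def DForm.interior {k : ℕ} (Z : ∀ p : M, TangentSpace I p) (η : DForm I M (k + 1)) :
    DForm I M k := fun p =>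
  { (η p).toAlternatingMap.curryLeft (Z p) with
    cont := (η p).cont.comp (continuous_const.finCons continuous_id) }

/-- The Lie derivative `L_Z η = d (i_Z η) + i_Z (d η)` of a form of positive degree. -/
def DForm.lie {k : ℕ} (Z : ∀ p : M, TangentSpace I p) (η : DForm I M (k + 1)) :
    DForm I M (k + 1) :=
  (η.interior Z).d + (η.d).interior Z

/-- The `1`-form with values `α p`. -/
def DForm.ofOneForm (α : ∀ p : M, TangentSpace I p →L[ℝ] ℝ) : DForm I M 1 := fun p =>
  ContinuousAlternatingMap.ofSubsingleton ℝ (TangentSpace I p) ℝ (0 : Fin 1) (α p)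

/-- The pull-back `f^* η`. -/
def DForm.pullback {E' : Type*} [NormedAddCommGroup E'] [NormedSpace ℝ E']
    {H' : Type*} [TopologicalSpace H'] {I' : ModelWithCorners ℝ E' H'}
    {N : Type*} [TopologicalSpace N] [ChartedSpace H' N] {k : ℕ}
    (f : N → M) (η : DForm I M k) : DForm I' N k := fun q =>
  (η (f q)).compContinuousLinearMap (mfderiv I' I f q)

/-- The characteristic subspace `K_m = ker Ω_m` of a `2`-form. -/
def DForm.ker (Ω : DForm I M 2) (m : M) : Submodule ℝ (TangentSpace I m) where
  carrier := {v | ∀ w, Ω m ![v, w] = 0}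
  zero_mem' w := (Ω m).map_coord_zero 0 rfl
  add_mem' {a b} ha hb w := by
    have h := (Ω m).toMultilinearMap.cons_add ![w] a b
    exact h.trans (by erw [ha w, hb w]; exact add_zero 0)
  smul_mem' c a ha w := by
    have h := (Ω m).toMultilinearMap.cons_smul ![w] c a
    exact h.trans (by erw [ha w]; exact smul_zero c)

/-- Smoothness of a vector field on the set `s`. -/
def SmoothFieldOn [IsManifold I ∞ M] (X : ∀ p : M, TangentSpace I p) (s : Set M) : Prop :=
  ContMDiffOn I I.tangent ∞ (fun p => (⟨p, X p⟩ : TangentBundle I M)) s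

end Forms

/-! ### The characteristic bundle, its dual, and connections -/

section Thickening

variable {E : Type*} [NormedAddCommGroup E] [NormedSpace ℝ E]
  {M : Type*} [TopologicalSpace M] [ChartedSpace E M]

/-- The fibre `K_m = ker Ω_m` of the characteristic bundle. -/
abbrev CharFiber (Ω : DForm 𝓘(ℝ, E) M 2) (m : M) : Type _ := Ω.ker m

/-- The fibre `K_m^*` of the dual of the characteristic bundle. -/
abbrev CharDual (Ω : DForm 𝓘(ℝ, E) M 2) (m : M) : Type _ := CharFiber Ω m →L[ℝ] Trivial M ℝ m

variable (F : Type*) [NormedAddCommGroup F] [NormedSpace ℝ F]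
  (Ω : DForm 𝓘(ℝ, E) M 2)
  [TopologicalSpace (TotalSpace F (CharFiber Ω))]
  [FiberBundle F (CharFiber Ω)] [VectorBundle ℝ F (CharFiber Ω)]

/-- The total space `K^*` of the dual bundle. -/
abbrev DualTotal : Type _ := TotalSpace (F →L[ℝ] ℝ) (CharDual Ω)

/-- The model with corners of `K^*`. -/
abbrev dualModel (E F : Type*) [NormedAddCommGroup E] [NormedSpace ℝ E]
    [NormedAddCommGroup F] [NormedSpace ℝ F] :
    ModelWithCorners ℝ (E × (F →L[ℝ] ℝ)) (ModelProd E (F →L[ℝ] ℝ)) :=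
  𝓘(ℝ, E).prod 𝓘(ℝ, F →L[ℝ] ℝ)

/-- The bundle structure chosen on `K = ker Ω` is that of a smooth subbundle of `TM`:
the inclusion `K → TM` is smooth. -/
def IsCharBundle [IsManifold 𝓘(ℝ, E) ∞ M] : Prop :=
  ContMDiff (𝓘(ℝ, E).prod 𝓘(ℝ, F)) 𝓘(ℝ, E).tangent ∞
    (fun k : TotalSpace F (CharFiber Ω) =>
      (⟨k.proj, (k.snd : TangentSpace 𝓘(ℝ, E) k.proj)⟩ : TangentBundle 𝓘(ℝ, E) M))

/-- A connection: a smooth bundle map `P : TM → K` restricting to the identity on `K`. -/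
structure IsConnection [IsManifold 𝓘(ℝ, E) ∞ M]
    (P : ∀ m : M, TangentSpace 𝓘(ℝ, E) m →L[ℝ] CharFiber Ω m) : Prop where
  smooth : ContMDiff 𝓘(ℝ, E).tangent (𝓘(ℝ, E).prod 𝓘(ℝ, F)) ∞
    (fun v : TangentBundle 𝓘(ℝ, E) M =>
      (⟨v.proj, P v.proj v.snd⟩ : TotalSpace F (CharFiber Ω)))
  proj : ∀ (m : M) (k : CharFiber Ω m), P m (k : TangentSpace 𝓘(ℝ, E) m) = k

end Thickening

section Lift

variable {E : Type*} [NormedAddCommGroup E] [NormedSpace ℝ E]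
  {M : Type*} [TopologicalSpace M] [ChartedSpace E M]
  {Ω : DForm 𝓘(ℝ, E) M 2}

/-- The vertical part `X_V = P X` of a vector field. -/
def vertPart (P : ∀ m : M, TangentSpace 𝓘(ℝ, E) m →L[ℝ] CharFiber Ω m)
    (X : ∀ m : M, TangentSpace 𝓘(ℝ, E) m) (m : M) : TangentSpace 𝓘(ℝ, E) m :=
  (P m (X m) : CharFiber Ω m)

/-- The horizontal part `X_H = X - P X` of a vector field. -/
def horPart (P : ∀ m : M, TangentSpace 𝓘(ℝ, E) m →L[ℝ] CharFiber Ω m)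
    (X : ∀ m : M, TangentSpace 𝓘(ℝ, E) m) (m : M) : TangentSpace 𝓘(ℝ, E) m :=
  X m - vertPart P X m

/-- `X` is a smooth horizontal vector field on the set `O`. -/
def IsHorizontalOn [IsManifold 𝓘(ℝ, E) ∞ M]
    (P : ∀ m : M, TangentSpace 𝓘(ℝ, E) m →L[ℝ] CharFiber Ω m)
    (X : ∀ m : M, TangentSpace 𝓘(ℝ, E) m) (O : Set M) : Prop :=
  SmoothFieldOn X O ∧ ∀ m ∈ O, P m (X m) = 0

/-- Flatness: the bracket of two (locally defined) horizontal vector fields is horizontal. -/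
def IsFlat [IsManifold 𝓘(ℝ, E) ∞ M]
    (P : ∀ m : M, TangentSpace 𝓘(ℝ, E) m →L[ℝ] CharFiber Ω m) : Prop :=
  ∀ (O : Set M), IsOpen O → ∀ X Y : (∀ m : M, TangentSpace 𝓘(ℝ, E) m),
    IsHorizontalOn P X O → IsHorizontalOn P Y O →
      ∀ m ∈ O, P m (VectorField.mlieBracket 𝓘(ℝ, E) X Y m) = 0

variable {F : Type*} [NormedAddCommGroup F] [NormedSpace ℝ F]
  [TopologicalSpace (TotalSpace F (CharFiber Ω))]
  [FiberBundle F (CharFiber Ω)] [VectorBundle ℝ F (CharFiber Ω)]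

/-- A smooth local frame of `K` over `O` (given as an `F`-valued frame `e_m : F ≃ K_m`) adapted
to `P`: each of its sections `V = e v` satisfies `P [X, V] = 0` for every local horizontal field
`X`, that is, the frame is invariant along the horizontal directions. The values of `e` off `O`
are irrelevant. -/
structure IsAdaptedFrame [IsManifold 𝓘(ℝ, E) ∞ M]
    (P : ∀ m : M, TangentSpace 𝓘(ℝ, E) m →L[ℝ] CharFiber Ω m)
    (O : Set M) (e : ∀ m : M, F ≃L[ℝ] CharFiber Ω m) : Prop where
  smooth : ContMDiffOn (𝓘(ℝ, E).prod 𝓘(ℝ, F)) (𝓘(ℝ, E).prod 𝓘(ℝ, F)) ∞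
    (fun x : M × F => (⟨x.1, e x.1 x.2⟩ : TotalSpace F (CharFiber Ω))) (O ×ˢ univ)
  invariant : ∀ (v : F) (O' : Set M), IsOpen O' → O' ⊆ O →
    ∀ X : (∀ m : M, TangentSpace 𝓘(ℝ, E) m), IsHorizontalOn P X O' →
      ∀ m ∈ O', P m (VectorField.mlieBracket 𝓘(ℝ, E) X
        (fun m' => ((e m' v : CharFiber Ω m') : TangentSpace 𝓘(ℝ, E) m')) m) = 0

/-- The linear fibre coordinate `μ ↦ μ (e v)` on `K^*` given by a frame `e` and `v : F`. -/
def fibreCoord (e : ∀ m : M, F ≃L[ℝ] CharFiber Ω m) (v : F) (μ : DualTotal F Ω) : ℝ :=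
  μ.snd (e μ.proj v)

/-- The tangent map `Tτ` of the projection `τ : K^* → M`. -/
def tangentProj (μ : DualTotal F Ω) :
    TangentSpace (dualModel E F) μ →L[ℝ] TangentSpace 𝓘(ℝ, E) μ.proj :=
  mfderiv (dualModel E F) 𝓘(ℝ, E) (fun ν : DualTotal F Ω => ν.proj) μ

/-- The `1`-form `ϑ^P_μ (X) = μ (P (Tτ X))` on `K^*`. -/
def thetaP (P : ∀ m : M, TangentSpace 𝓘(ℝ, E) m →L[ℝ] CharFiber Ω m) :
    DForm (dualModel E F) (DualTotal F Ω) 1 :=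
  DForm.ofOneForm fun μ => (show CharFiber Ω μ.proj →L[ℝ] ℝ from μ.snd) ∘L
    (P μ.proj ∘L tangentProj μ)

/-- The `2`-form `τ^* Ω + d ϑ^P` on `K^*`. -/
def omegaTilde (P : ∀ m : M, TangentSpace 𝓘(ℝ, E) m →L[ℝ] CharFiber Ω m) :
    DForm (dualModel E F) (DualTotal F Ω) 2 :=
  DForm.pullback (fun μ : DualTotal F Ω => μ.proj) Ω + (thetaP P).d

/-- `U` is an open neighbourhood of the zero section of `K^*` on which `τ^* Ω + d ϑ^P` is (weakly)
nondegenerate, so that it is (the domain of) a symplectic thickening. -/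
structure IsSymplecticThickening
    (P : ∀ m : M, TangentSpace 𝓘(ℝ, E) m →L[ℝ] CharFiber Ω m)
    (U : Set (DualTotal F Ω)) : Prop where
  isOpen : IsOpen U
  zero_mem : ∀ m : M, (⟨m, (0 : CharFiber Ω m →L[ℝ] ℝ)⟩ : DualTotal F Ω) ∈ U
  nondegenerate : ∀ μ ∈ U, (omegaTilde P).ker μ = ⊥

variable [IsManifold 𝓘(ℝ, E) ∞ M] [ContMDiffVectorBundle ∞ F (CharFiber Ω) 𝓘(ℝ, E)]

/-- `Z` is a lift to `U ⊆ K^*` of the vertical part of `X`: it is smooth and satisfies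
`Tτ Z = X_V` and `L_Z ϑ^P = 0` on `U`. -/
structure IsVerticalLift
    (P : ∀ m : M, TangentSpace 𝓘(ℝ, E) m →L[ℝ] CharFiber Ω m)
    (U : Set (DualTotal F Ω)) (X : ∀ m : M, TangentSpace 𝓘(ℝ, E) m)
    (Z : ∀ μ : DualTotal F Ω, TangentSpace (dualModel E F) μ) : Prop where
  smooth : SmoothFieldOn Z U
  proj : ∀ μ ∈ U, tangentProj μ (Z μ) = vertPart P X μ.proj
  lie : ∀ μ ∈ U, (thetaP P).lie Z μ = 0

/-- `Z` is a lift to `U ⊆ K^*` of the horizontal part of `X`: it is smooth, satisfies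
`Tτ Z = X_H` on `U`, and near every point is annihilated by the differentials of the fibre
coordinates of some local frame of `K` adapted to `P`. -/
structure IsHorizontalLift
    (P : ∀ m : M, TangentSpace 𝓘(ℝ, E) m →L[ℝ] CharFiber Ω m)
    (U : Set (DualTotal F Ω)) (X : ∀ m : M, TangentSpace 𝓘(ℝ, E) m)
    (Z : ∀ μ : DualTotal F Ω, TangentSpace (dualModel E F) μ) : Prop where
  smooth : SmoothFieldOn Z U
  proj : ∀ μ ∈ U, tangentProj μ (Z μ) = horPart P X μ.proj
  const : ∀ μ ∈ U, ∃ (O : Set M) (e : ∀ m : M, F ≃L[ℝ] CharFiber Ω m),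
    IsOpen O ∧ μ.proj ∈ O ∧ IsAdaptedFrame P O e ∧
    ∀ ν ∈ U, ν.proj ∈ O → ∀ v : F,
      mfderiv (dualModel E F) 𝓘(ℝ, ℝ) (fibreCoord e v) ν (Z ν) = 0

end Lift

end

/-!
Write `τ : K^* → M` for the projection. The form `ω̃ = τ^* ω + dϑ` is closed, so by Cartan's formula
it suffices that `i_Γ̃ ω̃` is closed. Since `Γ̃` projects to `Γ`,
`i_Γ̃ ω̃ = τ^* (i_Γ ω) + i_{Γ̃_V} dϑ + i_{Γ̃_H} dϑ`.
The first term is closed because `Γ` is Hamiltonian. The second is `-d (i_{Γ̃_V} ϑ)`, because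
`L_{Γ̃_V} ϑ = 0`. The third vanishes: for fields `Z`, `W` on `K^*` projecting to `X`, `Y`,
`dϑ (Z, W) = Z (μ (P Y)) - W (μ (P X)) - μ (P [X, Y])`,
and with `X = Γ_H` horizontal the value of `W` at a point can be realised by a field `Y` which is a
horizontal field plus a section `e v` of the adapted frame. Then `P [X, Y] = 0` by flatness and
adaptedness, and `μ (P Y) = μ_v` is constant along `Z = Γ̃_H`.
-/

noncomputable section

section Charts

variable {E : Type*} [NormedAddCommGroup E] [NormedSpace ℝ E]
  {H : Type*} [TopologicalSpace H] {I : ModelWithCorners ℝ E H}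
  {M : Type*} [TopologicalSpace M] [ChartedSpace H M]
  {E' : Type*} [NormedAddCommGroup E'] [NormedSpace ℝ E']
  {H' : Type*} [TopologicalSpace H'] {I' : ModelWithCorners ℝ E' H'}
  {N : Type*} [TopologicalSpace N] [ChartedSpace H' N] {n : WithTop ℕ∞}

theorem writtenInExtChartAt_self (f : N → M) (q : N) :
    writtenInExtChartAt I' I q f (extChartAt I' q q) = extChartAt I (f q) (f q) := by
  simp only [writtenInExtChartAt, Function.comp_apply, extChartAt_to_inv]

theorem contDiffAt_writtenInExtChartAt [I'.Boundaryless] {f : N → M} {q : N}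
    (hf : ContMDiffAt I' I n f q) :
    ContDiffAt ℝ n (writtenInExtChartAt I' I q f) (extChartAt I' q q) := by
  have hf' := (contMDiffAt_iff.1 hf).2
  rwa [I'.range_eq_univ, contDiffWithinAt_univ] at hf'

theorem mfderiv_eq_fderiv_writtenInExtChartAt [I'.Boundaryless] {f : N → M} {q : N}
    (hf : MDifferentiableAt I' I f q) :
    mfderiv I' I f q = fderiv ℝ (writtenInExtChartAt I' I q f) (extChartAt I' q q) := by
  rw [hf.mfderiv, I'.range_eq_univ, fderivWithin_univ]

theorem mfderiv_eq_fderiv_of_eventuallyEq [IsManifold I 1 M] {f : M → E'} {g : E → E'} {p : M}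
    (hg : DifferentiableAt ℝ g (extChartAt I p p))
    (hfg : f =ᶠ[𝓝 p] g ∘ extChartAt I p) :
    mfderiv I 𝓘(ℝ, E') f p = fderiv ℝ g (extChartAt I p p) := by
  have hchart : MDifferentiableAt I 𝓘(ℝ, E) (extChartAt I p) p :=
    mdifferentiableAt_extChartAt (mem_chart_source H p)
  rw [hfg.mfderiv_eq, mfderiv_comp p hg.mdifferentiableAt hchart, mfderiv_extChartAt_self,
    mfderiv_eq_fderiv]
  rfl

variable [I.Boundaryless]

theorem mdifferentiableAt_extChartAt_symm [IsManifold I 1 M] {p : M} {x : E}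
    (hx : x ∈ (extChartAt I p).target) : MDifferentiableAt 𝓘(ℝ, E) I (extChartAt I p).symm x :=
  (mdifferentiableOn_extChartAt_symm x hx).mdifferentiableAt (extChartAt_target_mem_nhds' hx)

theorem contMDiffAt_extChartAt_symm [IsManifold I n M] {p : M} {x : E}
    (hx : x ∈ (extChartAt I p).target) : ContMDiffAt 𝓘(ℝ, E) I n (extChartAt I p).symm x :=
  (contMDiffOn_extChartAt_symm p).contMDiffAt (extChartAt_target_mem_nhds' hx)

theorem mfderiv_extChartAt_symm_comp_fderiv [I'.Boundaryless] [IsManifold I 1 M]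
    [IsManifold I' 1 N] {f : N → M} {q : N} {y : E'} (hy : y ∈ (extChartAt I' q).target)
    (hfy : MDifferentiableAt I' I f ((extChartAt I' q).symm y))
    (hsource : f ((extChartAt I' q).symm y) ∈ (extChartAt I (f q)).source) (v : E') :
    mfderiv 𝓘(ℝ, E) I (extChartAt I (f q)).symm (writtenInExtChartAt I' I q f y)
        (fderiv ℝ (writtenInExtChartAt I' I q f) y v) =
      mfderiv I' I f ((extChartAt I' q).symm y)
        (mfderiv 𝓘(ℝ, E') I' (extChartAt I' q).symm y v) := by
  have hchart : MDifferentiableAt I 𝓘(ℝ, E) (extChartAt I (f q)) (f ((extChartAt I' q).symm y)) :=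
    mdifferentiableAt_extChartAt (by rwa [← extChartAt_source I])
  have hsymm := mdifferentiableAt_extChartAt_symm hy
  have hwritten : MDifferentiableAt 𝓘(ℝ, E') 𝓘(ℝ, E) (writtenInExtChartAt I' I q f) y :=
    hchart.comp y (hfy.comp y hsymm)
  have hsymm' : MDifferentiableAt 𝓘(ℝ, E) I (extChartAt I (f q)).symm
      (writtenInExtChartAt I' I q f y) :=
    mdifferentiableAt_extChartAt_symm ((extChartAt I (f q)).map_source hsource)
  have hnhds : ∀ᶠ z in 𝓝 y, f ((extChartAt I' q).symm z) ∈ (extChartAt I (f q)).source :=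
    (hfy.continuousAt.comp hsymm.continuousAt).eventually
      ((isOpen_extChartAt_source (f q)).mem_nhds hsource)
  have hcomp : (extChartAt I (f q)).symm ∘ writtenInExtChartAt I' I q f =ᶠ[𝓝 y]
      f ∘ (extChartAt I' q).symm := by
    filter_upwards [hnhds] with z hz using (extChartAt I (f q)).left_inv hz
  have hderiv := hcomp.mfderiv_eq (I := 𝓘(ℝ, E')) (I' := I)
  rw [mfderiv_comp y hsymm' hwritten, mfderiv_comp y hfy hsymm, mfderiv_eq_fderiv] at hderiv
  exact congrArg (fun L : E' →L[ℝ] E => L v) hderiv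

/-- The representative of a vector field in the preferred chart at `p`. -/
def chartField (X : ∀ p : M, TangentSpace I p) (p : M) : E → E :=
  VectorField.mpullback 𝓘(ℝ, E) I (extChartAt I p).symm X

section

variable [IsManifold I 1 M]

theorem mfderiv_extChartAt_symm_chartField (X : ∀ p : M, TangentSpace I p) {p : M} {x : E}
    (hx : x ∈ (extChartAt I p).target) :
    mfderiv 𝓘(ℝ, E) I (extChartAt I p).symm x (chartField (E := E) X p x) =
      X ((extChartAt I p).symm x) := by
  have hinv := isInvertible_mfderivWithin_extChartAt_symm hx
  rw [I.range_eq_univ, mfderivWithin_univ] at hinv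
  obtain ⟨e, he⟩ := hinv
  change mfderiv 𝓘(ℝ, E) I (extChartAt I p).symm x
    ((mfderiv 𝓘(ℝ, E) I (extChartAt I p).symm x).inverse _) = _
  rw [← he, ContinuousLinearMap.inverse_equiv]
  exact e.apply_symm_apply _

theorem chartField_eq_trivializationAt (X : ∀ p : M, TangentSpace I p) {p : M} {x : E}
    (hx : x ∈ (extChartAt I p).target) :
    chartField X p x = (trivializationAt E (TangentSpace I) p
      ⟨(extChartAt I p).symm x, X ((extChartAt I p).symm x)⟩).2 := by
  have hbase : (extChartAt I p).symm x ∈ (chartAt H p).source := by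
    rw [← extChartAt_source I]
    exact (extChartAt I p).map_target hx
  have hleft : mfderiv I 𝓘(ℝ, E) (extChartAt I p) ((extChartAt I p).symm x) ∘L
      mfderiv 𝓘(ℝ, E) I (extChartAt I p).symm x = .id ℝ _ := by
    have h := mfderiv_extChartAt_comp_mfderivWithin_extChartAt_symm hx
    rwa [I.range_eq_univ, mfderivWithin_univ] at h
  have hbase' : (extChartAt I p).symm x ∈ (trivializationAt E (TangentSpace I) p).baseSet := by
    rwa [TangentBundle.trivializationAt_baseSet]
  have hcoord := TangentBundle.continuousLinearMapAt_trivializationAt (I := I) hbase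
  have happly := (trivializationAt E (TangentSpace I) p).continuousLinearMapAt_apply_of_mem ℝ
    hbase' (X ((extChartAt I p).symm x))
  rw [← mfderiv_extChartAt_symm_chartField X hx] at happly ⊢
  exact (congrArg (fun L : E →L[ℝ] E => L (chartField X p x)) hleft).symm.trans <|
    (congrArg (fun L : E →L[ℝ] E => L _) hcoord).symm.trans happly

theorem mfderiv_extChartAt_symm_self (p : M) (v : E) :
    mfderiv 𝓘(ℝ, E) I (extChartAt I p).symm (extChartAt I p p) v = v := by
  have hid := mfderivWithin_range_extChartAt_symm (I := I) (x := p)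
  rw [I.range_eq_univ, mfderivWithin_univ] at hid
  rw [hid]
  rfl

theorem chartField_self (X : ∀ p : M, TangentSpace I p) (p : M) :
    chartField X p (extChartAt I p p) = X p := by
  have h := mfderiv_extChartAt_symm_chartField (I := I) X (mem_extChartAt_target p)
  rw [extChartAt_to_inv] at h
  exact (mfderiv_extChartAt_symm_self p _).symm.trans h

theorem contDiffAt_chartField {X : ∀ p : M, TangentSpace I p} {p : M} [IsManifold I n M]
    (hX : ContMDiffAt I I.tangent n (fun q => (⟨q, X q⟩ : TangentBundle I M)) p) :
    ContDiffAt ℝ n (chartField X p) (extChartAt I p p) := by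
  have hcoord := (contMDiffAt_section p).1 hX
  have hsymm := contMDiffAt_extChartAt_symm (n := n) (mem_extChartAt_target (I := I) p)
  refine ContDiffAt.congr_of_eventuallyEq (hcoord.comp_of_eq hsymm
    (extChartAt_to_inv p)).contDiffAt ?_
  filter_upwards [extChartAt_target_mem_nhds p] with x hx
  exact chartField_eq_trivializationAt X hx

theorem mlieBracket_eq_lieBracket_chartField (X Y : ∀ p : M, TangentSpace I p) (p : M) :
    VectorField.mlieBracket I X Y p =
      VectorField.lieBracket ℝ (chartField X p) (chartField Y p) (extChartAt I p p) := by
  rw [← VectorField.mlieBracketWithin_univ, VectorField.mlieBracketWithin_apply,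
    mfderiv_extChartAt_self]
  refine (congrArg (fun L : E →L[ℝ] E => L _)
    (ContinuousLinearMap.inverse_id (R := ℝ) (M := E))).trans ?_
  simp only [I.range_eq_univ, VectorField.mpullbackWithin_univ, preimage_univ, inter_univ]
  exact congrFun VectorField.lieBracketWithin_univ _

-- `VectorField.mlieBracket_add_right` requires the model space to be complete.
theorem mlieBracket_add_right_of_contMDiffAt (X : ∀ p : M, TangentSpace I p)
    {Y Y' : ∀ p : M, TangentSpace I p} {p : M}
    (hY : ContMDiffAt I I.tangent 1 (fun q => (⟨q, Y q⟩ : TangentBundle I M)) p)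
    (hY' : ContMDiffAt I I.tangent 1 (fun q => (⟨q, Y' q⟩ : TangentBundle I M)) p) :
    VectorField.mlieBracket I X (Y + Y') p =
      VectorField.mlieBracket I X Y p + VectorField.mlieBracket I X Y' p := by
  simp only [mlieBracket_eq_lieBracket_chartField]
  have hadd : chartField (Y + Y') p = fun x => chartField Y p x + chartField Y' p x :=
    funext fun x => map_add _ _ _
  exact (congrArg (fun Z : E → E => VectorField.lieBracket ℝ (chartField X p) Z _) hadd).trans
    (VectorField.lieBracket_add_right ((contDiffAt_chartField hY).differentiableAt one_ne_zero)
      ((contDiffAt_chartField hY').differentiableAt one_ne_zero))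

theorem contMDiffOn_mfderiv_extChartAt_symm [IsManifold I (n + 1) M] (p : M) :
    ContMDiffOn 𝓘(ℝ, E × E) I.tangent n
      (fun y : E × E => (⟨(extChartAt I p).symm y.1,
        mfderiv 𝓘(ℝ, E) I (extChartAt I p).symm y.1 y.2⟩ : TangentBundle I M))
      ((extChartAt I p).target ×ˢ univ) := by
  have htangent := (contMDiffOn_extChartAt_symm (n := n + 1) p).contMDiffOn_tangentMapWithin le_rfl
    (isOpen_extChartAt_target (I := I) p).uniqueMDiffOn
  have hmaps : ((extChartAt I p).target ×ˢ (univ : Set E)) ⊆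
      (tangentBundleModelSpaceHomeomorph 𝓘(ℝ, E)).symm ⁻¹'
        (TotalSpace.proj ⁻¹' (extChartAt I p).target) := fun y hy => hy.1
  rw [modelWithCornersSelf_prod]
  refine (htangent.comp (contMDiff_tangentBundleModelSpaceHomeomorph_symm
    (I := 𝓘(ℝ, E))).contMDiffOn hmaps).congr fun y hy => ?_
  rw [← mfderivWithin_of_isOpen (isOpen_extChartAt_target p) hy.1]
  rfl

end

end Charts

namespace DForm

variable {E : Type*} [NormedAddCommGroup E] [NormedSpace ℝ E]
  {H : Type*} [TopologicalSpace H] {I : ModelWithCorners ℝ E H}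
  {M : Type*} [TopologicalSpace M] [ChartedSpace H M]
  {E' : Type*} [NormedAddCommGroup E'] [NormedSpace ℝ E']
  {H' : Type*} [TopologicalSpace H'] {I' : ModelWithCorners ℝ E' H'}
  {N : Type*} [TopologicalSpace N] [ChartedSpace H' N] {k : ℕ} {n : WithTop ℕ∞}

/-- `η` is `C^n` at `p`: its representative in the preferred chart at `p` is. -/
def IsContDiffAt (n : WithTop ℕ∞) (η : DForm I M k) (p : M) : Prop :=
  ContDiffAt ℝ n (η.chartRep p) (extChartAt I p p)

theorem IsContDiffAt.of_le {m : WithTop ℕ∞} {η : DForm I M k} {p : M}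
    (hη : η.IsContDiffAt n p) (hmn : m ≤ n) : η.IsContDiffAt m p :=
  ContDiffAt.of_le hη hmn

theorem IsSmooth.isContDiffAt [I.Boundaryless] {η : DForm I M k} (hη : η.IsSmooth) (p : M) :
    η.IsContDiffAt ∞ p :=
  (hη p).contDiffAt (extChartAt_target_mem_nhds p)

theorem apply_congr (η : DForm I M k) {p q : M} (hpq : p = q) {v w : Fin k → E} (hvw : v = w) :
    (show (Fin k → E) → ℝ from η p) v = (show (Fin k → E) → ℝ from η q) w := by
  subst hpq hvw; rfl

theorem pullback_apply (f : N → M) (η : DForm I M k) (q : N) (v : Fin k → TangentSpace I' q) :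
    pullback (I' := I') f η q v = η (f q) fun i => mfderiv I' I f q (v i) := rfl

theorem interior_apply (Z : ∀ p : M, TangentSpace I p) (η : DForm I M (k + 1)) (p : M)
    (v : Fin k → TangentSpace I p) :
    η.interior Z p v = η p (Matrix.vecCons (Z p) v) := rfl

theorem interior_apply_fin_one (Z : ∀ p : M, TangentSpace I p) (η : DForm I M 2) (p : M)
    (v : Fin 1 → TangentSpace I p) : η.interior Z p v = η p ![Z p, v 0] := by
  rw [interior_apply]
  refine congrArg (η p) (funext fun i => ?_)
  fin_cases i <;> rfl

theorem interior_add (Z : ∀ p : M, TangentSpace I p) (η η' : DForm I M (k + 1)) :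
    (η + η').interior Z = η.interior Z + η'.interior Z := rfl

theorem interior_add_field (Z Z' : ∀ p : M, TangentSpace I p) (η : DForm I M (k + 1)) :
    η.interior (fun p => Z p + Z' p) = η.interior Z + η.interior Z' := by
  funext p
  ext v
  exact (η p).toMultilinearMap.cons_add v (Z p) (Z' p)

theorem interior_pullback {f : N → M} {q : N} {Z : ∀ q : N, TangentSpace I' q}
    {X : ∀ p : M, TangentSpace I p} (η : DForm I M (k + 1))
    (hZX : mfderiv I' I f q (Z q) = X (f q)) :
    (pullback (I' := I') f η).interior Z q = pullback (I' := I') f (η.interior X) q := by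
  ext v
  rw [pullback_apply, interior_apply, interior_apply, pullback_apply, ← hZX]
  refine congrArg (η (f q)) (funext fun i => ?_)
  cases i using Fin.cases <;> rfl

theorem chartRep_congr {η η' : DForm I M k} {p : M} (h : ∀ᶠ q in 𝓝 p, η q = η' q) :
    η.chartRep p =ᶠ[𝓝 (extChartAt I p p)] η'.chartRep p := by
  rw [← extChartAt_to_inv (I := I) p] at h
  filter_upwards [(continuousAt_extChartAt_symm p).eventually h] with x hx
  simp only [chartRep, hx]

theorem d_congr {η η' : DForm I M k} {p : M} (h : ∀ᶠ q in 𝓝 p, η q = η' q) :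
    η.d p = η'.d p := by
  simp only [d, (chartRep_congr h).extDeriv_eq]

theorem d_zero : (0 : DForm I M k).d = 0 := by
  funext p
  ext v
  have hzero : extDeriv (0 : E → E [⋀^Fin k]→L[ℝ] ℝ) (extChartAt I p p) = 0 := by
    simpa only [zero_smul] using
      extDeriv_smul (x := extChartAt I p p) (0 : ℝ) (0 : E → E [⋀^Fin k]→L[ℝ] ℝ)
  exact congrArg (fun ζ : E [⋀^Fin (k + 1)]→L[ℝ] ℝ => ζ fun i => mfderiv% (extChartAt I p) p (v i))
    hzero

theorem d_add {η η' : DForm I M k} {p : M}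
    (hη : DifferentiableAt ℝ (η.chartRep p) (extChartAt I p p))
    (hη' : DifferentiableAt ℝ (η'.chartRep p) (extChartAt I p p)) :
    (η + η').d p = η.d p + η'.d p := by
  ext v
  exact congrArg (fun ζ : E [⋀^Fin (k + 1)]→L[ℝ] ℝ => ζ fun i => mfderiv% (extChartAt I p) p (v i))
    (extDeriv_add hη hη')

theorem d_apply [IsManifold I 1 M] (η : DForm I M k) (p : M) (v : Fin (k + 1) → TangentSpace I p) :
    η.d p v = extDeriv (η.chartRep p) (extChartAt I p p) v := by
  change extDeriv (η.chartRep p) (extChartAt I p p)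
    (fun i => mfderiv I 𝓘(ℝ, E) (extChartAt I p) p (v i)) = _
  rw [mfderiv_extChartAt_self]
  rfl

section Boundaryless

variable [I.Boundaryless]

theorem chartRep_interior_eventuallyEq [IsManifold I 1 M] (Z : ∀ p : M, TangentSpace I p)
    (η : DForm I M (k + 1)) (p : M) :
    (η.interior Z).chartRep p =ᶠ[𝓝 (extChartAt I p p)] fun x =>
      (η.chartRep p x).curryLeft (chartField Z p x) := by
  filter_upwards [extChartAt_target_mem_nhds p] with x hx
  ext v
  refine apply_congr η rfl (funext fun i => ?_)
  cases i using Fin.cases with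
  | zero => exact (mfderiv_extChartAt_symm_chartField Z hx).symm
  | succ i => rfl

theorem IsContDiffAt.interior [IsManifold I 1 M] [IsManifold I n M]
    {Z : ∀ p : M, TangentSpace I p} {η : DForm I M (k + 1)} {p : M} (hη : η.IsContDiffAt n p)
    (hZ : ContMDiffAt I I.tangent n (fun q => (⟨q, Z q⟩ : TangentBundle I M)) p) :
    (η.interior Z).IsContDiffAt n p := by
  refine ContDiffAt.congr_of_eventuallyEq ?_ (chartRep_interior_eventuallyEq Z η p)
  let curry : (E [⋀^Fin (k + 1)]→L[ℝ] ℝ) →ₗᵢ[ℝ] (E →L[ℝ] E [⋀^Fin k]→L[ℝ] ℝ) :=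
    ContinuousAlternatingMap.curryLeftLI
  exact (curry.contDiff.contDiffAt.comp _ hη).clm_apply (contDiffAt_chartField hZ)

section Naturality

variable [I'.Boundaryless] [IsManifold I 1 M] [IsManifold I' 1 N]

theorem chartRep_pullback_eventuallyEq {f : N → M} {q : N} (hf : ContMDiffAt I' I 1 f q)
    (η : DForm I M k) :
    (pullback (I' := I') f η).chartRep q =ᶠ[𝓝 (extChartAt I' q q)] fun y =>
      (η.chartRep (f q) (writtenInExtChartAt I' I q f y)).compContinuousLinearMap
        (fderiv ℝ (writtenInExtChartAt I' I q f) y) := by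
  have hnear : ∀ᶠ q' in 𝓝 q, ContMDiffAt I' I 1 f q' ∧ f q' ∈ (extChartAt I (f q)).source :=
    ((contMDiffAt_iff_contMDiffAt_nhds (by simp)).1 hf).and
      (hf.continuousAt.eventually (extChartAt_source_mem_nhds (f q)))
  rw [← extChartAt_to_inv (I := I') q] at hnear
  filter_upwards [(continuousAt_extChartAt_symm q).eventually hnear,
    extChartAt_target_mem_nhds (I := I') q] with y ⟨hfy, hsource⟩ hy
  rw [extChartAt_to_inv] at hsource
  ext v
  refine apply_congr η ((extChartAt I (f q)).left_inv hsource).symm (funext fun i => ?_)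
  exact (mfderiv_extChartAt_symm_comp_fderiv hy (hfy.mdifferentiableAt one_ne_zero) hsource
    (v i)).symm

theorem differentiableAt_chartRep_pullback {f : N → M} {q : N} (hf : ContMDiffAt I' I 2 f q)
    {η : DForm I M k} (hη : DifferentiableAt ℝ (η.chartRep (f q)) (extChartAt I (f q) (f q))) :
    DifferentiableAt ℝ ((pullback (I' := I') f η).chartRep q) (extChartAt I' q q) := by
  have hwritten := contDiffAt_writtenInExtChartAt hf
  rw [← writtenInExtChartAt_self (I' := I')] at hη
  exact ((hη.comp _ (hwritten.differentiableAt two_ne_zero)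
    ).continuousAlternatingMapCompContinuousLinearMap
      ((hwritten.fderiv_right (m := 1) (by norm_num)).differentiableAt one_ne_zero)
    ).congr_of_eventuallyEq (chartRep_pullback_eventuallyEq (hf.of_le one_le_two) η)

theorem d_pullback {f : N → M} {q : N} (hf : ContMDiffAt I' I 2 f q) {η : DForm I M k}
    (hη : DifferentiableAt ℝ (η.chartRep (f q)) (extChartAt I (f q) (f q))) :
    (pullback (I' := I') f η).d q = pullback (I' := I') f η.d q := by
  have hf' : ContMDiffAt I' I 1 f q := hf.of_le one_le_two
  rw [← writtenInExtChartAt_self (I' := I')] at hη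
  ext v
  rw [d_apply, (chartRep_pullback_eventuallyEq hf' η).extDeriv_eq,
    extDeriv_pullback hη (contDiffAt_writtenInExtChartAt hf) (by simp), pullback_apply,
    d_apply, writtenInExtChartAt_self,
    mfderiv_eq_fderiv_writtenInExtChartAt (hf'.mdifferentiableAt one_ne_zero)]
  rfl

end Naturality

theorem chartRep_vectorSpace (η : DForm 𝓘(ℝ, E) E k) (x : E) :
    η.chartRep x = fun y => (η y).compContinuousLinearMap
      (NormedSpace.fromTangentSpace (𝕜 := ℝ) y).symm.toContinuousLinearMap := by
  funext y
  ext v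
  have hsymm : ((extChartAt 𝓘(ℝ, E) x).symm : E → E) = id := by
    rw [extChartAt_model_space_eq_id]; rfl
  refine apply_congr η (congrFun hsymm y) (funext fun i => ?_)
  rw [hsymm, mfderiv_id]
  rfl

section ExteriorDerivative

variable [IsManifold I 2 M]

theorem chartRep_d {η : DForm I M k} {p : M} {x : E} (hx : x ∈ (extChartAt I p).target)
    (hη : η.IsContDiffAt 1 ((extChartAt I p).symm x)) :
    η.d.chartRep p x = extDeriv (η.chartRep p) x := by
  ext v
  refine (congrArg (fun ζ : E [⋀^Fin (k + 1)]→L[ℝ] ℝ => ζ v)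
    (d_pullback (contMDiffAt_extChartAt_symm hx) (hη.differentiableAt one_ne_zero))).symm.trans ?_
  refine (d_apply (I := 𝓘(ℝ, E)) _ x v).trans ?_
  rw [chartRep_vectorSpace]
  rfl

theorem chartRep_d_eventuallyEq {η : DForm I M k} {p : M}
    (hη : ∀ᶠ q in 𝓝 p, η.IsContDiffAt 1 q) :
    η.d.chartRep p =ᶠ[𝓝 (extChartAt I p p)] extDeriv (η.chartRep p) := by
  rw [← extChartAt_to_inv (I := I) p] at hη
  filter_upwards [(continuousAt_extChartAt_symm p).eventually hη,
    extChartAt_target_mem_nhds (I := I) p] with x hηx hx using chartRep_d hx hηx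

theorem IsContDiffAt.d {η : DForm I M k} {p : M} (hηp : η.IsContDiffAt (n + 1) p)
    (hη : ∀ᶠ q in 𝓝 p, η.IsContDiffAt 1 q) : η.d.IsContDiffAt n p := by
  refine ContDiffAt.congr_of_eventuallyEq ?_ (chartRep_d_eventuallyEq hη)
  exact (ContinuousAlternatingMap.alternatizeUncurryFinCLM ℝ E ℝ).contDiff.contDiffAt.comp _
    (ContDiffAt.fderiv_right hηp le_rfl)

theorem d_d {η : DForm I M k} {p : M} (hη : ∀ᶠ q in 𝓝 p, η.IsContDiffAt 2 q) :
    η.d.d p = 0 := by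
  ext v
  rw [d_apply, (chartRep_d_eventuallyEq (hη.mono fun q hq => hq.of_le one_le_two)).extDeriv_eq,
    extDeriv_extDeriv_apply hη.self_of_nhds (by simp)]
  rfl

theorem d_interior_d_eq_zero_of_lie_eq_zero {Z : ∀ p : M, TangentSpace I p}
    {η : DForm I M (k + 1)} {p : M} (hη : ∀ᶠ q in 𝓝 p, η.IsContDiffAt 2 q)
    (hZ : ∀ᶠ q in 𝓝 p, ContMDiffAt I I.tangent 2 (fun q => (⟨q, Z q⟩ : TangentBundle I M)) q)
    (hlie : ∀ᶠ q in 𝓝 p, η.lie Z q = 0) : ((η.d).interior Z).d p = 0 := by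
  have hη₁ := hη.mono fun q hq => hq.of_le one_le_two
  have hinterior : ∀ᶠ q in 𝓝 p, (η.interior Z).IsContDiffAt 2 q :=
    (hη.and hZ).mono fun q hq => hq.1.interior hq.2
  have hdinterior : (η.interior Z).d.IsContDiffAt 1 p :=
    IsContDiffAt.d (by simpa [one_add_one_eq_two] using hinterior.self_of_nhds)
      (hinterior.mono fun q hq => hq.of_le one_le_two)
  have hinteriord : ((η.d).interior Z).IsContDiffAt 1 p :=
    (IsContDiffAt.d (by simpa [one_add_one_eq_two] using hη.self_of_nhds) hη₁).interior
      (hZ.self_of_nhds.of_le one_le_two)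
  calc ((η.d).interior Z).d p = (η.interior Z).d.d p + ((η.d).interior Z).d p := by
        rw [d_d hinterior, zero_add]
    _ = (η.lie Z).d p := (d_add (hdinterior.differentiableAt one_ne_zero)
        (hinteriord.differentiableAt one_ne_zero)).symm
    _ = (0 : DForm I M (k + 1)).d p := d_congr hlie
    _ = 0 := congrFun d_zero p

end ExteriorDerivative

section Functions

variable (I) in
/-- A function regarded as a form of degree zero. -/
def ofFunction (g : M → ℝ) : DForm I M 0 := fun p =>
  ContinuousAlternatingMap.constOfIsEmpty ℝ _ (Fin 0) (g p)

theorem isContDiffAt_ofFunction {g : M → ℝ} {p : M} (hg : ContMDiffAt I 𝓘(ℝ, ℝ) n g p) :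
    (ofFunction I g).IsContDiffAt n p :=
  (ContinuousAlternatingMap.constOfIsEmptyLIE ℝ E ℝ (Fin 0)).contDiff.contDiffAt.comp _
    (contDiffAt_writtenInExtChartAt hg)

theorem d_ofFunction_apply [IsManifold I 1 M] {g : M → ℝ} {p : M}
    (hg : MDifferentiableAt I 𝓘(ℝ, ℝ) g p) (v : Fin 1 → TangentSpace I p) :
    (ofFunction I g).d p v = mfderiv I 𝓘(ℝ, ℝ) g p (v 0) := by
  rw [d_apply, mfderiv_eq_fderiv_writtenInExtChartAt hg]
  exact congrArg (fun ζ : E [⋀^Fin 1]→L[ℝ] ℝ => ζ v) (extDeriv_constOfIsEmpty _ _)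

theorem d_interior_eq_zero_of_apply_eq_mfderiv [IsManifold I 2 M] {η : DForm I M 2}
    {Z : ∀ p : M, TangentSpace I p} {h : M → ℝ} (hh : ContMDiff I 𝓘(ℝ, ℝ) 2 h)
    (hZ : ∀ (p : M) (v : TangentSpace I p), η p ![Z p, v] = mfderiv I 𝓘(ℝ, ℝ) h p v) :
    (η.interior Z).d = 0 := by
  have : IsManifold I 1 M := .of_le one_le_two
  have hexact : η.interior Z = (ofFunction I h).d := by
    funext p
    ext v
    rw [d_ofFunction_apply (hh.mdifferentiableAt two_ne_zero), ← hZ, interior_apply_fin_one]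
  funext p
  rw [hexact]
  exact d_d (.of_forall fun q => isContDiffAt_ofFunction (hh q))

end Functions

end Boundaryless

end DForm

section Calculus

variable {E : Type*} [NormedAddCommGroup E] [NormedSpace ℝ E]
  {E' : Type*} [NormedAddCommGroup E'] [NormedSpace ℝ E']
  {F : Type*} [NormedAddCommGroup F] [NormedSpace ℝ F]

-- The linear map `L x` is recovered as the derivative at `0` of its restriction to a fibre.
theorem contDiffOn_of_contDiffOn_uncurry {m n : WithTop ℕ∞} (hmn : m + 1 ≤ n)
    {L : E → E' →L[ℝ] F} {s : Set E} (hs : IsOpen s)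
    (hL : ContDiffOn ℝ n (fun y : E × E' => L y.1 y.2) (s ×ˢ univ)) : ContDiffOn ℝ m L s := by
  have hopen : IsOpen (s ×ˢ (univ : Set E')) := hs.prod isOpen_univ
  have hfderiv : ContDiffOn ℝ m
      (fun x => fderiv ℝ (fun y : E × E' => L y.1 y.2) (x, 0) ∘L .inr ℝ E E') s :=
    ((hL.fderiv_of_isOpen hopen hmn).comp
      (contDiff_id.prodMk contDiff_const).contDiffOn fun x hx => ⟨hx, mem_univ _⟩).clm_comp
      contDiffOn_const
  refine hfderiv.congr fun x hx => ?_
  have hdiff : DifferentiableAt ℝ (fun y : E × E' => L y.1 y.2) (x, 0) :=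
    (hL.contDiffAt (hopen.mem_nhds ⟨hx, mem_univ _⟩)).differentiableAt
      fun h => by simp [h] at hmn
  exact (L x).hasFDerivAt.unique
    (hdiff.hasFDerivAt.comp (0 : E') (hasFDerivAt_prodMk_right x (0 : E')))

variable {n : WithTop ℕ∞} {L : E → E →L[ℝ] F} {x : E}

theorem contDiffAt_ofSubsingleton (hL : ContDiffAt ℝ n L x) :
    ContDiffAt ℝ n (fun y => ContinuousAlternatingMap.ofSubsingleton ℝ E F (0 : Fin 1) (L y)) x :=
  (ContinuousAlternatingMap.ofSubsingletonLIE (𝕜 := ℝ) (E := E) (F := F)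
    (0 : Fin 1)).contDiff.contDiffAt.comp _ hL

theorem extDeriv_ofSubsingleton_apply (hL : DifferentiableAt ℝ L x) (v w : E) :
    extDeriv (fun y => ContinuousAlternatingMap.ofSubsingleton ℝ E F (0 : Fin 1) (L y)) x ![v, w] =
      fderiv ℝ L x v w - fderiv ℝ L x w v := by
  have hform : DifferentiableAt ℝ
      (fun y => ContinuousAlternatingMap.ofSubsingleton ℝ E F (0 : Fin 1) (L y)) x :=
    (ContinuousAlternatingMap.ofSubsingletonLIE (𝕜 := ℝ) (E := E) (F := F)
      (0 : Fin 1)).differentiable.differentiableAt.comp _ hL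
  rw [extDeriv_apply hform, Fin.sum_univ_two]
  simp [Fin.removeNth, sub_eq_add_neg, fderiv_clm_apply hL]

theorem extDeriv_ofSubsingleton_apply_vectorField {V W : E → E} (hL : DifferentiableAt ℝ L x)
    (hV : DifferentiableAt ℝ V x) (hW : DifferentiableAt ℝ W x) :
    extDeriv (fun y => ContinuousAlternatingMap.ofSubsingleton ℝ E F (0 : Fin 1) (L y)) x
        ![V x, W x] =
      fderiv ℝ (fun y => L y (W y)) x (V x) - fderiv ℝ (fun y => L y (V y)) x (W x) -
        L x (VectorField.lieBracket ℝ V W x) := by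
  rw [extDeriv_ofSubsingleton_apply hL, fderiv_clm_apply hL hW, fderiv_clm_apply hL hV]
  simp only [VectorField.lieBracket, add_apply, ContinuousLinearMap.comp_apply,
    ContinuousLinearMap.flip_apply, map_sub]
  abel

theorem fst_lieBracket_prodMk {f g : E → E} {y : E × E'} (hf : DifferentiableAt ℝ f y.1)
    (hg : DifferentiableAt ℝ g y.1) (c d : E') :
    (VectorField.lieBracket ℝ (fun z : E × E' => (f z.1, c)) (fun z => (g z.1, d)) y).1 =
      VectorField.lieBracket ℝ f g y.1 := by
  have hlift : ∀ {h : E → E}, DifferentiableAt ℝ h y.1 → ∀ (c : E') (u : E × E'),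
      (fderiv ℝ (fun z : E × E' => (h z.1, c)) y u).1 = fderiv ℝ h y.1 u.1 := by
    intro h hh c u
    have hcomp := (hh.hasFDerivAt.comp y hasFDerivAt_fst).prodMk (hasFDerivAt_const c y)
    exact congrArg (fun L : E × E' →L[ℝ] E × E' => (L u).1) hcomp.fderiv
  simp only [VectorField.lieBracket, Prod.fst_sub, hlift hf, hlift hg]

theorem extDeriv_snd_comp_apply_vectorField {p : E → E →L[ℝ] E'} {f g : E → E}
    {y : E × (E' →L[ℝ] F)} (hp : DifferentiableAt ℝ p y.1) (hf : DifferentiableAt ℝ f y.1)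
    (hg : DifferentiableAt ℝ g y.1) (c d : E' →L[ℝ] F) :
    extDeriv (fun z : E × (E' →L[ℝ] F) => ContinuousAlternatingMap.ofSubsingleton ℝ _ F (0 : Fin 1)
        (z.2 ∘L p z.1 ∘L ContinuousLinearMap.fst ℝ E (E' →L[ℝ] F))) y
        ![(f y.1, c), (g y.1, d)] =
      fderiv ℝ (fun z : E × (E' →L[ℝ] F) => z.2 (p z.1 (g z.1))) y (f y.1, c) -
        fderiv ℝ (fun z : E × (E' →L[ℝ] F) => z.2 (p z.1 (f z.1))) y (g y.1, d) -
          y.2 (p y.1 (VectorField.lieBracket ℝ f g y.1)) := by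
  rw [← fst_lieBracket_prodMk hf hg c d]
  exact extDeriv_ofSubsingleton_apply_vectorField
    (V := fun z : E × (E' →L[ℝ] F) => (f z.1, c)) (W := fun z => (g z.1, d))
    (differentiableAt_snd.clm_comp ((hp.comp y differentiableAt_fst).clm_comp
      (differentiableAt_const _)))
    ((hf.comp y differentiableAt_fst).prodMk (differentiableAt_const c))
    ((hg.comp y differentiableAt_fst).prodMk (differentiableAt_const d))

end Calculus

section LocalConnection

variable {E : Type*} [NormedAddCommGroup E] [NormedSpace ℝ E]
  {M : Type*} [TopologicalSpace M] [ChartedSpace E M] {Ω : DForm 𝓘(ℝ, E) M 2}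
  {F : Type*} [NormedAddCommGroup F]
  [TopologicalSpace (TotalSpace F (CharFiber Ω))] [FiberBundle F (CharFiber Ω)]
  {P : ∀ m : M, TangentSpace 𝓘(ℝ, E) m →L[ℝ] CharFiber Ω m}
  {X : ∀ m : M, TangentSpace 𝓘(ℝ, E) m} {O : Set M}

variable (Ω F) in
/-- The part of the target of the preferred chart at `m₀` over which the preferred trivialization of
the characteristic bundle at `m₀` is defined. -/
def chartDomain (m₀ : M) : Set E :=
  (extChartAt 𝓘(ℝ, E) m₀).target ∩
    (extChartAt 𝓘(ℝ, E) m₀).symm ⁻¹' (trivializationAt F (CharFiber Ω) m₀).baseSet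

theorem isOpen_chartDomain (m₀ : M) : IsOpen (chartDomain Ω F m₀) :=
  (continuousOn_extChartAt_symm m₀).isOpen_inter_preimage (isOpen_extChartAt_target m₀)
    (trivializationAt F (CharFiber Ω) m₀).open_baseSet

theorem mem_chartDomain (m₀ : M) : extChartAt 𝓘(ℝ, E) m₀ m₀ ∈ chartDomain Ω F m₀ :=
  ⟨mem_extChartAt_target m₀, by
    rw [mem_preimage, extChartAt_to_inv]
    exact mem_baseSet_trivializationAt F _ m₀⟩

variable [NormedSpace ℝ F]

section

variable [IsManifold 𝓘(ℝ, E) ∞ M]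

theorem smoothFieldOn_vertPart (hK : IsCharBundle F Ω) (hP : IsConnection F Ω P)
    (hX : SmoothFieldOn X O) : SmoothFieldOn (vertPart P X) O :=
  hK.comp_contMDiffOn (hP.smooth.comp_contMDiffOn hX)

theorem isHorizontalOn_horPart (hK : IsCharBundle F Ω) (hP : IsConnection F Ω P)
    (hX : SmoothFieldOn X O) : IsHorizontalOn P (horPart P X) O := by
  have : IsManifold 𝓘(ℝ, E) (∞ + 1) M := by simpa
  refine ⟨ContMDiffOn.sub_section hX (smoothFieldOn_vertPart hK hP hX), fun m _ => ?_⟩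
  change P m (X m - (P m (X m) : CharFiber Ω m)) = 0
  rw [map_sub, hP.proj, sub_self]

theorem exists_isHorizontalOn_eq (hK : IsCharBundle F Ω) (hP : IsConnection F Ω P) {m : M}
    {η : TangentSpace 𝓘(ℝ, E) m} (hη : P m η = 0) :
    ∃ (O : Set M) (Y : ∀ q : M, TangentSpace 𝓘(ℝ, E) q),
      IsOpen O ∧ m ∈ O ∧ IsHorizontalOn P Y O ∧ Y m = η := by
  have : IsManifold 𝓘(ℝ, E) (∞ + 1) M := by simpa
  obtain ⟨s, hs, hsmooth⟩ :=
    FiberBundle.exists_contMDiffOn_extend (k := ∞) 𝓘(ℝ, E) (V := TangentSpace 𝓘(ℝ, E)) E η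
  obtain ⟨O, hOs, hO, hm⟩ := mem_nhds_iff.1 hs
  refine ⟨O, horPart P (FiberBundle.extend E η), hO, hm,
    isHorizontalOn_horPart hK hP (hsmooth.mono hOs), ?_⟩
  change FiberBundle.extend E η m - (P m (FiberBundle.extend E η m) : CharFiber Ω m) = η
  rw [FiberBundle.extend_apply_self, hη]
  exact sub_zero η

theorem IsAdaptedFrame.smoothFieldOn (hK : IsCharBundle F Ω)
    {e : ∀ m : M, F ≃L[ℝ] CharFiber Ω m} (he : IsAdaptedFrame P O e) (v : F) :
    SmoothFieldOn (fun m => ((e m v : CharFiber Ω m) : TangentSpace 𝓘(ℝ, E) m)) O :=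
  hK.comp_contMDiffOn (he.smooth.comp
    (contMDiff_id.prodMk contMDiff_const : ContMDiff _ _ _ fun m : M => (m, v)).contMDiffOn
      fun _ hm => ⟨hm, mem_univ _⟩)

theorem IsAdaptedFrame.exists_extension (hK : IsCharBundle F Ω) (hP : IsConnection F Ω P)
    (hflat : IsFlat P) {e : ∀ m : M, F ≃L[ℝ] CharFiber Ω m} (he : IsAdaptedFrame P O e)
    (hO : IsOpen O) (hX : IsHorizontalOn P X O) {m : M} (hm : m ∈ O)
    (ξ : TangentSpace 𝓘(ℝ, E) m) :
    ∃ (v : F) (Y : ∀ q : M, TangentSpace 𝓘(ℝ, E) q),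
      ContMDiffAt 𝓘(ℝ, E) 𝓘(ℝ, E).tangent ∞
        (fun q => (⟨q, Y q⟩ : TangentBundle 𝓘(ℝ, E) M)) m ∧ Y m = ξ ∧
      (∀ᶠ q in 𝓝 m, P q (Y q) = e q v) ∧ P m (VectorField.mlieBracket 𝓘(ℝ, E) X Y m) = 0 := by
  have : IsManifold 𝓘(ℝ, E) (∞ + 1) M := by simpa
  have : IsManifold 𝓘(ℝ, E) 1 M := .of_le (n := ∞) (by norm_cast)
  set v : F := (e m).symm (P m ξ) with hv
  set V : ∀ q : M, TangentSpace 𝓘(ℝ, E) q := fun q => (e q v : CharFiber Ω q) with hV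
  have hVξ : P m (ξ - V m) = 0 := by
    rw [map_sub, hV, hP.proj, hv, ContinuousLinearEquiv.apply_symm_apply, sub_self]
  obtain ⟨O', Y, hO', hm', hY, hYm⟩ := exists_isHorizontalOn_eq hK hP hVξ
  have hVsmooth := (he.smoothFieldOn hK v).contMDiffAt (hO.mem_nhds hm)
  have hYsmooth := hY.1.contMDiffAt (hO'.mem_nhds hm')
  refine ⟨v, V + Y, hVsmooth.add_section hYsmooth, ?_, ?_, ?_⟩
  · rw [Pi.add_apply, hYm, add_sub_cancel]
  · filter_upwards [hO'.mem_nhds hm'] with q hq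
    rw [Pi.add_apply, map_add, hY.2 q hq, add_zero, hV, hP.proj]
  · rw [mlieBracket_add_right_of_contMDiffAt X (hVsmooth.of_le (by norm_cast))
      (hYsmooth.of_le (by norm_cast)), map_add, he.invariant v O hO subset_rfl X hX m hm,
      hflat (O ∩ O') (hO.inter hO') X Y ⟨hX.1.mono inter_subset_left, fun q hq => hX.2 q hq.1⟩
        ⟨hY.1.mono inter_subset_right, fun q hq => hY.2 q hq.2⟩ m ⟨hm, hm'⟩, add_zero]

end

variable [VectorBundle ℝ F (CharFiber Ω)]

variable (F P) in
/-- The representative of a connection in the preferred chart and trivialization at `m₀`. -/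
def chartProj (m₀ : M) (x : E) : E →L[ℝ] F :=
  (trivializationAt F (CharFiber Ω) m₀).continuousLinearMapAt ℝ ((extChartAt 𝓘(ℝ, E) m₀).symm x) ∘L
    P ((extChartAt 𝓘(ℝ, E) m₀).symm x) ∘L
      (mfderiv 𝓘(ℝ, E) 𝓘(ℝ, E) (extChartAt 𝓘(ℝ, E) m₀).symm x ∘L
        (NormedSpace.fromTangentSpace (𝕜 := ℝ) x).symm.toContinuousLinearMap)

variable [IsManifold 𝓘(ℝ, E) ∞ M]

theorem chartProj_chartField (X : ∀ m : M, TangentSpace 𝓘(ℝ, E) m) {m₀ : M} {x : E}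
    (hx : x ∈ (extChartAt 𝓘(ℝ, E) m₀).target) :
    chartProj F P m₀ x (chartField X m₀ x) =
      (trivializationAt F (CharFiber Ω) m₀).continuousLinearMapAt ℝ
        ((extChartAt 𝓘(ℝ, E) m₀).symm x) (P _ (X ((extChartAt 𝓘(ℝ, E) m₀).symm x))) := by
  have : IsManifold 𝓘(ℝ, E) 1 M := .of_le (n := ∞) (by norm_cast)
  rw [← mfderiv_extChartAt_symm_chartField X hx]
  rfl

variable [ContMDiffVectorBundle ∞ F (CharFiber Ω) 𝓘(ℝ, E)]

theorem contDiffOn_chartProj (hP : IsConnection F Ω P) (m₀ : M) :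
    ContDiffOn ℝ ∞ (chartProj F P m₀) (chartDomain Ω F m₀) := by
  have : IsManifold 𝓘(ℝ, E) (∞ + 1) M := by simpa
  refine contDiffOn_of_contDiffOn_uncurry (m := ∞) (n := ∞) (by simp) (isOpen_chartDomain m₀) ?_
  have hcomp : ContMDiffOn 𝓘(ℝ, E × E) (𝓘(ℝ, E).prod 𝓘(ℝ, F)) ∞ _ (chartDomain Ω F m₀ ×ˢ univ) :=
    (hP.smooth.comp_contMDiffOn (contMDiffOn_mfderiv_extChartAt_symm m₀)).mono
      (prod_mono inter_subset_left subset_rfl)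
  have hcoord := ((trivializationAt F (CharFiber Ω) m₀).contMDiffOn_iff fun y hy => by
    rw [Trivialization.mem_source]
    exact hy.1.2).1 hcomp
  refine (contMDiffOn_iff_contDiffOn.1 hcoord.2).congr fun y hy => ?_
  exact (trivializationAt F (CharFiber Ω) m₀).continuousLinearMapAt_apply_of_mem ℝ hy.1.2 _

theorem contDiffAt_chartProj (hP : IsConnection F Ω P) (m₀ : M) :
    ContDiffAt ℝ ∞ (chartProj F P m₀) (extChartAt 𝓘(ℝ, E) m₀ m₀) :=
  (contDiffOn_chartProj hP m₀).contDiffAt ((isOpen_chartDomain m₀).mem_nhds (mem_chartDomain m₀))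

end LocalConnection

section DualBundle

variable {E : Type*} [NormedAddCommGroup E] [NormedSpace ℝ E]
  {M : Type*} [TopologicalSpace M] [ChartedSpace E M] {Ω : DForm 𝓘(ℝ, E) M 2}
  {F : Type*} [NormedAddCommGroup F] [NormedSpace ℝ F]
  [TopologicalSpace (TotalSpace F (CharFiber Ω))]
  [FiberBundle F (CharFiber Ω)] [VectorBundle ℝ F (CharFiber Ω)]
  {P : ∀ m : M, TangentSpace 𝓘(ℝ, E) m →L[ℝ] CharFiber Ω m}

theorem extChartAt_dual_target (μ : DualTotal F Ω) :
    (extChartAt (dualModel E F) μ).target = chartDomain Ω F μ.proj ×ˢ univ := by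
  rw [FiberBundle.extChartAt_target]
  simp [chartDomain]

theorem extChartAt_dual_fst (μ : DualTotal F Ω) :
    (extChartAt (dualModel E F) μ μ).1 = extChartAt 𝓘(ℝ, E) μ.proj μ.proj := by
  rw [FiberBundle.extChartAt]
  rfl

theorem extChartAt_dual_symm (μ : DualTotal F Ω) (y : E × (F →L[ℝ] ℝ)) :
    (extChartAt (dualModel E F) μ).symm y =
      ⟨(extChartAt 𝓘(ℝ, E) μ.proj).symm y.1,
        y.2 ∘L (trivializationAt F (CharFiber Ω) μ.proj).continuousLinearMapAt ℝ
          ((extChartAt 𝓘(ℝ, E) μ.proj).symm y.1)⟩ := by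
  rw [FiberBundle.extChartAt, hom_trivializationAt]
  change (⟨_, ContinuousLinearMap.comp _ _⟩ : DualTotal F Ω) = _
  congr 1
  ext k
  simp only [Trivial.fiberBundle_trivializationAt', Trivial.symmL_trivialization]
  rfl

theorem writtenInExtChartAt_proj (μ : DualTotal F Ω) {y : E × (F →L[ℝ] ℝ)}
    (hy : y ∈ (extChartAt (dualModel E F) μ).target) :
    writtenInExtChartAt (dualModel E F) 𝓘(ℝ, E) μ (fun ν : DualTotal F Ω => ν.proj) y = y.1 := by
  rw [extChartAt_dual_target] at hy
  simp only [writtenInExtChartAt, Function.comp_apply, extChartAt_dual_symm]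
  exact (extChartAt 𝓘(ℝ, E) μ.proj).right_inv hy.1.1

theorem fderiv_writtenInExtChartAt_proj (μ : DualTotal F Ω) {y : E × (F →L[ℝ] ℝ)}
    (hy : y ∈ (extChartAt (dualModel E F) μ).target) :
    fderiv ℝ (writtenInExtChartAt (dualModel E F) 𝓘(ℝ, E) μ fun ν : DualTotal F Ω => ν.proj) y =
      ContinuousLinearMap.fst ℝ E (F →L[ℝ] ℝ) := by
  refine Eq.trans (Filter.EventuallyEq.fderiv_eq ?_) fderiv_fst
  filter_upwards [extChartAt_target_mem_nhds' hy] with z hz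
  exact writtenInExtChartAt_proj μ hz

theorem tangentProj_apply (μ : DualTotal F Ω) (w : TangentSpace (dualModel E F) μ) :
    tangentProj μ w = w.1 := by
  have hproj : MDifferentiableAt (dualModel E F) 𝓘(ℝ, E) (fun ν : DualTotal F Ω => ν.proj) μ :=
    (contMDiffAt_proj (n := 1) (CharDual Ω)).mdifferentiableAt one_ne_zero
  have h := (mfderiv_eq_fderiv_writtenInExtChartAt hproj).trans
    (fderiv_writtenInExtChartAt_proj μ (mem_extChartAt_target μ))
  exact congrArg (fun L : E × (F →L[ℝ] ℝ) →L[ℝ] E => L w) h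

variable (P) in
/-- The function `μ ↦ μ (P X)` on `K^*`, the value of `ϑ^P` on the lifts of the vector field `X`. -/
def momentum (X : ∀ m : M, TangentSpace 𝓘(ℝ, E) m) (μ : DualTotal F Ω) : ℝ :=
  μ.snd (P μ.proj (X μ.proj))

variable [IsManifold 𝓘(ℝ, E) ∞ M]

theorem momentum_extChartAt_symm (X : ∀ m : M, TangentSpace 𝓘(ℝ, E) m) (μ : DualTotal F Ω)
    {y : E × (F →L[ℝ] ℝ)} (hy : y ∈ (extChartAt (dualModel E F) μ).target) :
    momentum P X ((extChartAt (dualModel E F) μ).symm y) =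
      y.2 (chartProj F P μ.proj y.1 (chartField X μ.proj y.1)) := by
  rw [extChartAt_dual_target] at hy
  rw [extChartAt_dual_symm, chartProj_chartField X hy.1.1]
  rfl

theorem differentiableAt_chartField_proj {X : ∀ m : M, TangentSpace 𝓘(ℝ, E) m}
    {μ : DualTotal F Ω} (hX : ContMDiffAt 𝓘(ℝ, E) 𝓘(ℝ, E).tangent 1
      (fun m => (⟨m, X m⟩ : TangentBundle 𝓘(ℝ, E) M)) μ.proj) :
    DifferentiableAt ℝ (chartField X μ.proj) (extChartAt (dualModel E F) μ μ).1 := by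
  have : IsManifold 𝓘(ℝ, E) 1 M := .of_le (n := ∞) (by norm_cast)
  rw [extChartAt_dual_fst]
  exact (contDiffAt_chartField hX).differentiableAt one_ne_zero

variable [ContMDiffVectorBundle ∞ F (CharFiber Ω) 𝓘(ℝ, E)]

theorem tangentProj_mfderiv_extChartAt_symm (μ : DualTotal F Ω) {y : E × (F →L[ℝ] ℝ)}
    (hy : y ∈ (extChartAt (dualModel E F) μ).target) (w : E × (F →L[ℝ] ℝ)) :
    (show E from tangentProj ((extChartAt (dualModel E F) μ).symm y)
      (mfderiv 𝓘(ℝ, E × (F →L[ℝ] ℝ)) (dualModel E F) (extChartAt (dualModel E F) μ).symm y w)) =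
    (show E → E from mfderiv 𝓘(ℝ, E) 𝓘(ℝ, E) (extChartAt 𝓘(ℝ, E) μ.proj).symm y.1) w.1 := by
  have : IsManifold 𝓘(ℝ, E) 1 M := .of_le (n := ∞) (by norm_cast)
  have : IsManifold (dualModel E F) 1 (DualTotal F Ω) := .of_le (n := ∞) (by norm_cast)
  have hproj := (contMDiffAt_proj (n := 1) (IB := 𝓘(ℝ, E)) (F := F →L[ℝ] ℝ) (CharDual Ω)
    (p := (extChartAt (dualModel E F) μ).symm y)).mdifferentiableAt one_ne_zero
  have hsource : ((extChartAt (dualModel E F) μ).symm y).proj ∈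
      (extChartAt 𝓘(ℝ, E) μ.proj).source := by
    rw [extChartAt_dual_target] at hy
    rw [extChartAt_dual_symm]
    exact (extChartAt 𝓘(ℝ, E) μ.proj).map_target hy.1.1
  have h := mfderiv_extChartAt_symm_comp_fderiv hy hproj hsource w
  rw [fderiv_writtenInExtChartAt_proj μ hy, writtenInExtChartAt_proj μ hy] at h
  exact h.symm

theorem chartRep_thetaP (μ : DualTotal F Ω) {y : E × (F →L[ℝ] ℝ)}
    (hy : y ∈ (extChartAt (dualModel E F) μ).target) :
    (thetaP P).chartRep μ y = ContinuousAlternatingMap.ofSubsingleton ℝ _ ℝ (0 : Fin 1)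
      (y.2 ∘L chartProj F P μ.proj y.1 ∘L ContinuousLinearMap.fst ℝ E (F →L[ℝ] ℝ)) := by
  have hpair : ∀ (ν : DualTotal F Ω) (m : M) (α : CharFiber Ω m →L[ℝ] ℝ) (u w : E), ν = ⟨m, α⟩ →
      u = w → ν.snd (P ν.proj u) = α (P m w) := by
    rintro ν m α u w rfl rfl
    rfl
  ext v
  exact hpair _ _ _ _ _ (extChartAt_dual_symm μ y) (tangentProj_mfderiv_extChartAt_symm μ hy (v 0))

theorem chartRep_thetaP_eventuallyEq (μ : DualTotal F Ω) :
    (thetaP P).chartRep μ =ᶠ[𝓝 (extChartAt (dualModel E F) μ μ)] fun y =>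
      ContinuousAlternatingMap.ofSubsingleton ℝ _ ℝ (0 : Fin 1)
        (y.2 ∘L chartProj F P μ.proj y.1 ∘L ContinuousLinearMap.fst ℝ E (F →L[ℝ] ℝ)) := by
  filter_upwards [extChartAt_target_mem_nhds μ] with y hy
  exact chartRep_thetaP μ hy

theorem isContDiffAt_thetaP (hP : IsConnection F Ω P) (μ : DualTotal F Ω) :
    (thetaP P).IsContDiffAt ∞ μ := by
  have hp := contDiffAt_chartProj hP μ.proj
  rw [← extChartAt_dual_fst] at hp
  refine ContDiffAt.congr_of_eventuallyEq ?_ (chartRep_thetaP_eventuallyEq μ)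
  exact contDiffAt_ofSubsingleton
    (contDiffAt_snd.clm_comp ((hp.fun_comp _ contDiffAt_fst).clm_comp contDiffAt_const))

section

variable {X Y : ∀ m : M, TangentSpace 𝓘(ℝ, E) m} {μ : DualTotal F Ω}

theorem differentiableAt_chartProj_proj (hP : IsConnection F Ω P) (μ : DualTotal F Ω) :
    DifferentiableAt ℝ (chartProj F P μ.proj) (extChartAt (dualModel E F) μ μ).1 := by
  rw [extChartAt_dual_fst]
  exact (contDiffAt_chartProj hP μ.proj).differentiableAt (by simp)

theorem mvfderiv_momentum (hP : IsConnection F Ω P)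
    (hX : ContMDiffAt 𝓘(ℝ, E) 𝓘(ℝ, E).tangent 1
      (fun m => (⟨m, X m⟩ : TangentBundle 𝓘(ℝ, E) M)) μ.proj) :
    mvfderiv (dualModel E F) (momentum P X) μ =
      fderiv ℝ (fun y : E × (F →L[ℝ] ℝ) =>
        y.2 (chartProj F P μ.proj y.1 (chartField X μ.proj y.1)))
        (extChartAt (dualModel E F) μ μ) := by
  have : IsManifold 𝓘(ℝ, E) 1 M := .of_le (n := ∞) (by norm_cast)
  refine mfderiv_eq_fderiv_of_eventuallyEq ?_ ?_
  · exact differentiableAt_snd.clm_apply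
      (((differentiableAt_chartProj_proj hP μ).clm_apply
        (differentiableAt_chartField_proj hX)).comp _ differentiableAt_fst)
  · filter_upwards [extChartAt_source_mem_nhds (I := dualModel E F) μ] with ν hν
    rw [Function.comp_apply, ← momentum_extChartAt_symm X μ
      ((extChartAt (dualModel E F) μ).map_source hν), (extChartAt _ μ).left_inv hν]

theorem d_thetaP_apply (hP : IsConnection F Ω P)
    (hX : ContMDiffAt 𝓘(ℝ, E) 𝓘(ℝ, E).tangent 1
      (fun m => (⟨m, X m⟩ : TangentBundle 𝓘(ℝ, E) M)) μ.proj)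
    (hY : ContMDiffAt 𝓘(ℝ, E) 𝓘(ℝ, E).tangent 1
      (fun m => (⟨m, Y m⟩ : TangentBundle 𝓘(ℝ, E) M)) μ.proj)
    {z w : TangentSpace (dualModel E F) μ} (hz : tangentProj μ z = X μ.proj)
    (hw : tangentProj μ w = Y μ.proj) :
    (thetaP P).d μ ![z, w] =
      mvfderiv (dualModel E F) (momentum P Y) μ z -
        mvfderiv (dualModel E F) (momentum P X) μ w -
          momentum P (VectorField.mlieBracket 𝓘(ℝ, E) X Y) μ := by
  have : IsManifold 𝓘(ℝ, E) 1 M := .of_le (n := ∞) (by norm_cast)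
  have hp := differentiableAt_chartProj_proj hP μ
  have hz' : chartField X μ.proj (extChartAt (dualModel E F) μ μ).1 = z.1 := by
    rw [extChartAt_dual_fst, chartField_self, ← hz, tangentProj_apply]
  have hw' : chartField Y μ.proj (extChartAt (dualModel E F) μ μ).1 = w.1 := by
    rw [extChartAt_dual_fst, chartField_self, ← hw, tangentProj_apply]
  have hbracket : (extChartAt (dualModel E F) μ μ).2 (chartProj F P μ.proj
      (extChartAt (dualModel E F) μ μ).1 (VectorField.lieBracket ℝ (chartField X μ.proj)
        (chartField Y μ.proj) (extChartAt (dualModel E F) μ μ).1)) =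
      momentum P (VectorField.mlieBracket 𝓘(ℝ, E) X Y) μ := by
    have h := momentum_extChartAt_symm (P := P) (VectorField.mlieBracket 𝓘(ℝ, E) X Y) μ
      (mem_extChartAt_target μ)
    rw [extChartAt_to_inv, extChartAt_dual_fst, chartField_self,
      mlieBracket_eq_lieBracket_chartField] at h
    rw [h, extChartAt_dual_fst]
  rw [mvfderiv_momentum hP hX, mvfderiv_momentum hP hY, ← hbracket, DForm.d_apply,
    (chartRep_thetaP_eventuallyEq μ).extDeriv_eq]
  have hformula := extDeriv_snd_comp_apply_vectorField hp (differentiableAt_chartField_proj hX)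
    (differentiableAt_chartField_proj hY) z.2 w.2
  rw [hz', hw'] at hformula
  exact hformula

theorem interior_d_thetaP_of_isHorizontalLift (hK : IsCharBundle F Ω) (hP : IsConnection F Ω P)
    (hflat : IsFlat P) (hX : SmoothFieldOn X univ) {U : Set (DualTotal F Ω)}
    {Z : ∀ ν : DualTotal F Ω, TangentSpace (dualModel E F) ν} (hZ : IsHorizontalLift P U X Z)
    (hμ : μ ∈ U) : ((thetaP P).d).interior Z μ = 0 := by
  obtain ⟨O, e, hO, hμO, he, hconst⟩ := hZ.const μ hμ
  have hhor : IsHorizontalOn P (horPart P X) O :=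
    isHorizontalOn_horPart hK hP (hX.mono (subset_univ O))
  have hproj : ContinuousAt (fun ν : DualTotal F Ω => ν.proj) μ :=
    (FiberBundle.continuous_proj (F →L[ℝ] ℝ) (CharDual Ω)).continuousAt
  ext w
  obtain ⟨v, Y, hY, hYw, hYe, hbracket⟩ :=
    he.exists_extension hK hP hflat hO hhor hμO (tangentProj μ (w 0))
  have hYcoord : momentum P Y =ᶠ[𝓝 μ] fibreCoord e v := by
    filter_upwards [hproj.eventually hYe] with ν hν using congrArg ν.snd hν
  have hXzero : momentum (F := F) P (horPart P X) =ᶠ[𝓝 μ] fun _ => 0 := by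
    filter_upwards [hproj.eventually (hO.mem_nhds hμO)] with ν hν
    exact (congrArg ν.snd (hhor.2 _ hν)).trans (map_zero ν.snd)
  have hbracketzero :
      momentum P (VectorField.mlieBracket 𝓘(ℝ, E) (horPart P X) Y) μ = 0 :=
    (congrArg μ.snd hbracket).trans (map_zero μ.snd)
  have hformula := d_thetaP_apply hP ((hhor.1.contMDiffAt (hO.mem_nhds hμO)).of_le (by simp))
    (hY.of_le (by simp)) (hZ.proj μ hμ) hYw.symm
  have hYderiv : mvfderiv (dualModel E F) (momentum P Y) μ (Z μ) = 0 :=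
    (congrArg (fun L : E × (F →L[ℝ] ℝ) →L[ℝ] ℝ => L (Z μ)) hYcoord.mfderiv_eq).trans
      (hconst μ hμ hμO v)
  have hXderiv : mvfderiv (dualModel E F) (momentum (F := F) P (horPart P X)) μ (w 0) = 0 :=
    congrArg (fun L : E × (F →L[ℝ] ℝ) →L[ℝ] ℝ => L (w 0)) (hXzero.mfderiv_eq.trans mfderiv_const)
  rw [DForm.interior_apply_fin_one, hformula, hYderiv, hXderiv, hbracketzero, sub_zero,
    sub_zero]
  rfl

end

end DualBundle

section Lifts

variable {E : Type*} [NormedAddCommGroup E] [NormedSpace ℝ E]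
  {M : Type*} [TopologicalSpace M] [ChartedSpace E M] [IsManifold 𝓘(ℝ, E) ∞ M]
  {Ω : DForm 𝓘(ℝ, E) M 2}
  {F : Type*} [NormedAddCommGroup F] [NormedSpace ℝ F]
  [TopologicalSpace (TotalSpace F (CharFiber Ω))]
  [FiberBundle F (CharFiber Ω)] [VectorBundle ℝ F (CharFiber Ω)]
  [ContMDiffVectorBundle ∞ F (CharFiber Ω) 𝓘(ℝ, E)]
  {P : ∀ m : M, TangentSpace 𝓘(ℝ, E) m →L[ℝ] CharFiber Ω m}

theorem d_omegaTilde (hP : IsConnection F Ω P) (hΩ : Ω.IsSmooth) (hΩd : Ω.d = 0) :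
    (omegaTilde (F := F) P).d = 0 := by
  have : IsManifold 𝓘(ℝ, E) 1 M := .of_le (n := ∞) (by norm_cast)
  have : IsManifold (dualModel E F) 1 (DualTotal F Ω) := .of_le (n := ∞) (by norm_cast)
  have : IsManifold (dualModel E F) 2 (DualTotal F Ω) := .of_le (n := ∞) (by norm_cast)
  funext μ
  have hproj : ContMDiffAt (dualModel E F) 𝓘(ℝ, E) 2 (fun ν : DualTotal F Ω => ν.proj) μ :=
    contMDiffAt_proj (CharDual Ω)
  have hΩμ := (hΩ.isContDiffAt μ.proj).differentiableAt (by simp)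
  have hθ : ∀ ν, (thetaP (F := F) P).IsContDiffAt 2 ν := fun ν =>
    (isContDiffAt_thetaP hP ν).of_le (by norm_cast)
  have hdθ : (thetaP P).d.IsContDiffAt 1 μ :=
    .d (by simpa [one_add_one_eq_two] using hθ μ) (.of_forall fun ν => (hθ ν).of_le one_le_two)
  rw [omegaTilde, DForm.d_add (DForm.differentiableAt_chartRep_pullback hproj hΩμ)
    (hdθ.differentiableAt one_ne_zero), DForm.d_pullback hproj hΩμ, hΩd,
    DForm.d_d (.of_forall hθ), add_zero]
  rfl

theorem interior_omegaTilde_eq (hK : IsCharBundle F Ω) (hP : IsConnection F Ω P)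
    (hflat : IsFlat P) {X : ∀ m : M, TangentSpace 𝓘(ℝ, E) m} (hX : SmoothFieldOn X univ)
    {U : Set (DualTotal F Ω)} {ZV ZH : ∀ μ : DualTotal F Ω, TangentSpace (dualModel E F) μ}
    (hV : IsVerticalLift P U X ZV) (hH : IsHorizontalLift P U X ZH) {μ : DualTotal F Ω}
    (hμ : μ ∈ U) :
    (omegaTilde P).interior (fun ν => ZV ν + ZH ν) μ =
      (DForm.pullback (I' := dualModel E F) (fun ν : DualTotal F Ω => ν.proj) (Ω.interior X) +
        ((thetaP P).d).interior ZV) μ := by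
  have hproj : tangentProj μ (ZV μ + ZH μ) = X μ.proj := by
    rw [(tangentProj μ).map_add, hV.proj μ hμ, hH.proj μ hμ, horPart, add_sub_cancel]
  rw [omegaTilde, DForm.interior_add, DForm.interior_add_field ZV ZH (thetaP P).d, Pi.add_apply,
    DForm.interior_pullback Ω hproj, Pi.add_apply,
    interior_d_thetaP_of_isHorizontalLift hK hP hflat hX hH hμ, add_zero, Pi.add_apply]

theorem d_interior_omegaTilde (hΩ : Ω.IsSmooth) (hK : IsCharBundle F Ω) (hP : IsConnection F Ω P)
    (hflat : IsFlat P) {X : ∀ m : M, TangentSpace 𝓘(ℝ, E) m} (hX : SmoothFieldOn X univ)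
    (hXΩ : (Ω.interior X).d = 0) {U : Set (DualTotal F Ω)} (hU : IsOpen U)
    {ZV ZH : ∀ μ : DualTotal F Ω, TangentSpace (dualModel E F) μ}
    (hV : IsVerticalLift P U X ZV) (hH : IsHorizontalLift P U X ZH) {μ : DualTotal F Ω}
    (hμ : μ ∈ U) :
    ((omegaTilde P).interior fun ν => ZV ν + ZH ν).d μ = 0 := by
  have : IsManifold 𝓘(ℝ, E) 1 M := .of_le (n := ∞) (by norm_cast)
  have : IsManifold (dualModel E F) 1 (DualTotal F Ω) := .of_le (n := ∞) (by norm_cast)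
  have : IsManifold (dualModel E F) 2 (DualTotal F Ω) := .of_le (n := ∞) (by norm_cast)
  have hproj : ContMDiffAt (dualModel E F) 𝓘(ℝ, E) 2 (fun ν : DualTotal F Ω => ν.proj) μ :=
    contMDiffAt_proj (CharDual Ω)
  have hXΩμ : (Ω.interior X).IsContDiffAt 1 μ.proj :=
    ((hΩ.isContDiffAt _).of_le (by simp)).interior ((contMDiffOn_univ.1 hX _).of_le (by simp))
  have hU_nhds : ∀ᶠ ν in 𝓝 μ, ν ∈ U := hU.mem_nhds hμ
  have hθ : ∀ ν, (thetaP (F := F) P).IsContDiffAt 2 ν := fun ν =>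
    (isContDiffAt_thetaP hP ν).of_le (by norm_cast)
  have hVsmooth : ∀ ν ∈ U, ContMDiffAt (dualModel E F) (dualModel E F).tangent 2
      (fun ν => (⟨ν, ZV ν⟩ : TangentBundle (dualModel E F) (DualTotal F Ω))) ν := fun ν hν =>
    (hV.smooth.contMDiffAt (hU.mem_nhds hν)).of_le (by norm_cast)
  have hdθ : ((thetaP P).d.interior ZV).IsContDiffAt 1 μ :=
    .interior (.d (by simpa [one_add_one_eq_two] using hθ μ)
      (.of_forall fun ν => (hθ ν).of_le one_le_two)) ((hVsmooth μ hμ).of_le one_le_two)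
  rw [DForm.d_congr (hU_nhds.mono fun ν hν => interior_omegaTilde_eq hK hP hflat hX hV hH hν),
    DForm.d_add (DForm.differentiableAt_chartRep_pullback hproj
      (hXΩμ.differentiableAt one_ne_zero)) (hdθ.differentiableAt one_ne_zero),
    DForm.d_pullback hproj (hXΩμ.differentiableAt one_ne_zero), hXΩ,
    DForm.d_interior_d_eq_zero_of_lie_eq_zero (.of_forall hθ) (hU_nhds.mono hVsmooth)
      (hU_nhds.mono hV.lie), add_zero]
  rfl

theorem mainTheorem1_general (hΩ : Ω.IsSmooth) (hΩd : Ω.d = 0) (hK : IsCharBundle F Ω)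
    (hP : IsConnection F Ω P) (hflat : IsFlat P) {U : Set (DualTotal F Ω)} (hU : IsOpen U)
    {Γ : ∀ m : M, TangentSpace 𝓘(ℝ, E) m} (hΓ : SmoothFieldOn Γ univ)
    (hΓΩ : (Ω.interior Γ).d = 0)
    {ΓV ΓH : ∀ μ : DualTotal F Ω, TangentSpace (dualModel E F) μ}
    (hV : IsVerticalLift P U Γ ΓV) (hH : IsHorizontalLift P U Γ ΓH) :
    ∀ μ ∈ U, (omegaTilde P).lie (fun ν => ΓV ν + ΓH ν) μ = 0 := by
  intro μ hμ
  rw [DForm.lie, Pi.add_apply, d_interior_omegaTilde hΩ hK hP hflat hΓ hΓΩ hU hV hH hμ,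
    d_omegaTilde hP hΩ hΩd, zero_add]
  rfl

end Lifts

end

theorem mainTheorem1
    {E : Type*} [NormedAddCommGroup E] [NormedSpace ℝ E] [CompleteSpace E]
    {M : Type*} [TopologicalSpace M] [ChartedSpace E M] [IsManifold 𝓘(ℝ, E) ∞ M]
    -- a closed `2`-form whose kernel is a smooth subbundle of `TM` with typical fibre `F`
    (Ω : DForm 𝓘(ℝ, E) M 2) (hΩ : Ω.IsSmooth) (hΩd : Ω.d = 0)
    {F : Type*} [NormedAddCommGroup F] [NormedSpace ℝ F]
    [TopologicalSpace (TotalSpace F (CharFiber Ω))]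
    [FiberBundle F (CharFiber Ω)] [VectorBundle ℝ F (CharFiber Ω)]
    [ContMDiffVectorBundle ∞ F (CharFiber Ω) 𝓘(ℝ, E)]
    (hK : IsCharBundle F Ω)
    -- a flat connection and a symplectic thickening constructed from it
    (P : ∀ m : M, TangentSpace 𝓘(ℝ, E) m →L[ℝ] CharFiber Ω m)
    (hP : IsConnection F Ω P) (hflat : IsFlat P)
    (U : Set (DualTotal F Ω)) (hU : IsSymplecticThickening P U)
    -- a vector field `Γ` with `i_Γ Ω = dh`
    (Γ : ∀ m : M, TangentSpace 𝓘(ℝ, E) m) (hΓ : SmoothFieldOn Γ univ)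
    (h : M → ℝ) (hh : ContMDiff 𝓘(ℝ, E) 𝓘(ℝ, ℝ) ∞ h)
    (hΓh : ∀ (m : M) (v : TangentSpace 𝓘(ℝ, E) m),
      Ω m ![Γ m, v] = mfderiv 𝓘(ℝ, E) 𝓘(ℝ, ℝ) h m v)
    -- its lift `ΓV + ΓH`
    (ΓV ΓH : ∀ μ : DualTotal F Ω, TangentSpace (dualModel E F) μ)
    (hV : IsVerticalLift P U Γ ΓV) (hH : IsHorizontalLift P U Γ ΓH) :
    ∀ μ ∈ U, (omegaTilde P).lie (fun ν => ΓV ν + ΓH ν) μ = 0 :=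
  have : IsManifold 𝓘(ℝ, E) 2 M := .of_le (n := ∞) (by norm_cast)
  mainTheorem1_general hΩ hΩd hK hP hflat hU.isOpen hΓ
    (DForm.d_interior_eq_zero_of_apply_eq_mfderiv (hh.of_le (by norm_cast)) hΓh) hV hH
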